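/- Let $\mathbb{C}_+=\{s\in\mathbb{C}:\operatorname{Re}s>0\}$. For $q>0$ let $H^q(\mathbb{C}_+)$ be the Hardy space of all functions $\Phi$ analytic on $\mathbb{C}_+$ with $\sup_{x>0}\left(\frac1{2\pi}\int_{-\infty}^{\infty}|\Phi(x+iy)|^q\,dy\right)^{1/q}<\infty$. Let $\mathcal{L}(g)(s)=\int_0^\infty e^{-st}g(t)\,dt$ be the Laplace transform and $\mathcal{L}^{-1}$ its inverse, so that for $\varphi\in L^{q}(0,\infty)$ with $1\le q<\infty$ the equation $\varphi=\mathcal{L}^{-1}(\Phi)$ means $\mathcal{L}(\varphi)=\Phi$ on $\mathbb{C}_+$. An expression that is at first defined only on a subset of $\mathbb{C}_+$ with non-empty interior is said to belong to $H^q(\mathbb{C}_+)$ if it is the restriction to that subset of a (then unique) function of $H^q(\mathbb{C}_+)$, with which it is identified. Let $f$ be analytic on a region $D\supseteq\mathbb{C}_+$ and not identically zero, and let $1<p\le 2$ and $\frac1p+\frac1{p'}=1$. Fix a function $r$ that is analytic on a region $E$ meeting $\mathbb{C}_+$. For $J\in L^{p'}(0,\infty)$, a function $\varphi\in L^{p'}(0,\infty)$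 is called a solution of the equation $f(\partial_t)\varphi=J$ (with respect to $r$) if the function $f\,\mathcal{L}(\varphi)-r$, given on $E\cap\mathbb{C}_+$, belongs to $H^p(\mathbb{C}_+)$, and $\mathcal{L}^{-1}\bigl(f\,\mathcal{L}(\varphi)-r\bigr)=J$. **Theorem.** Let $J\in L^{p'}(0,\infty)$ be such that $\mathcal{L}(J)\in H^p(\mathbb{C}_+)$, and assume that the function $(\mathcal{L}(J)+r)/f$, given on $\{s\in E\cap\mathbb{C}_+: f(s)\neq0\}$, belongs to $H^p(\mathbb{C}_+)$. Then the equation $f(\partial_t)\varphi=J$ has a unique solution $\varphi$ in $L^{p'}(0,\infty)$. Moreover, $(\mathcal{L}(J)+r)/f$ has exactly one inverse Laplace transform in $L^{p'}(0,\infty)$, and the solution is given by $$\varphi=\mathcal{L}^{-1}\left(\frac{\mathcal{L}(J)+r}{f}\right).$$ -/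

import Mathlib

open MeasureTheory Set
open scoped ENNReal NNReal

noncomputable section

namespace NonlocalEq

/-- A region of the complex plane: a non-empty connected open set. -/
def IsRegion (D : Set ℂ) : Prop := IsOpen D ∧ IsConnected D

/-- The open right half-plane `{s | Re s > 0}`. -/
def RightHalfPlane : Set ℂ := {s : ℂ | 0 < s.re}

/-- The complex Lebesgue space `L^q(0, ∞)`, as the space of almost everywhere equality classes. -/
abbrev LpHalfLine (q : ℝ) := Lp ℂ (ENNReal.ofReal q) (volume.restrict (Ioi (0 : ℝ)))

/-- The Laplace transform `∫_0^∞ e^{-st} g(t) dt`. For `g` in `L^q(0, ∞)` with `1 ≤ q < ∞` the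
integral converges absolutely at every `s` with `Re s > 0`. -/
def laplace (g : ℝ → ℂ) (s : ℂ) : ℂ :=
  ∫ t in Ioi (0 : ℝ), Complex.exp (-s * (t : ℂ)) * g t

/-- The mean `μ_q(Φ, x) = ((1 / 2π) ∫ |Φ(x + iy)|^q dy)^{1/q}`, as an extended non-negative real
number (so it is infinite when the integral diverges). -/
def hardyMean (q : ℝ) (Φ : ℂ → ℂ) (x : ℝ) : ℝ≥0∞ :=
  (ENNReal.ofReal (1 / (2 * Real.pi)) *
    ∫⁻ y : ℝ, ‖Φ ((x : ℂ) + (y : ℂ) * Complex.I)‖ₑ ^ q) ^ (1 / q)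

/-- Membership in the Hardy space `H^q` of the right half-plane. Only the values of `Φ` on the
right half-plane matter. -/
def MemHardy (q : ℝ) (Φ : ℂ → ℂ) : Prop :=
  AnalyticOnNhd ℂ Φ RightHalfPlane ∧ ∃ C : ℝ≥0, ∀ x : ℝ, 0 < x → hardyMean q Φ x ≤ C

/-- The expression `g`, given on the subset `U` of the right half-plane, is the function `G` of the
Hardy space `H^q`: `G` belongs to `H^q` and equals `g` on `U`. When `U` contains a non-empty open
set, there is (up to values off the half-plane) at most one such `G`. -/
def IsHardyFunction (q : ℝ) (U : Set ℂ) (g G : ℂ → ℂ) : Prop :=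
  MemHardy q G ∧ EqOn G g U

/-- `φ = L⁻¹ Φ` in `L^q(0, ∞)`: the Laplace transform of `φ` is `Φ` on the right half-plane. -/
def IsInverseLaplace (q : ℝ) (Φ : ℂ → ℂ) (φ : LpHalfLine q) : Prop :=
  EqOn (laplace φ) Φ RightHalfPlane

/-- `Φ` is the element `f L(φ) - r` of `H^p`, for `r` analytic on `E`. The pair `(φ, r)` is in the
domain of `f(∂_t)` if and only if there is such a `Φ`. -/
def IsHat (p q : ℝ) (f r : ℂ → ℂ) (E : Set ℂ) (φ : LpHalfLine q) (Φ : ℂ → ℂ) : Prop :=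
  IsHardyFunction p (E ∩ RightHalfPlane) (fun s => f s * laplace φ s - r s) Φ

/-- `φ` is a solution in `L^q(0, ∞)` of `f(∂_t) φ = J`, for the fixed function `r` analytic
on `E`: `f L(φ) - r` is in `H^p`, and its inverse Laplace transform is `J`. -/
def IsSolution (p q : ℝ) (f r : ℂ → ℂ) (E : Set ℂ) (J φ : LpHalfLine q) : Prop :=
  ∃ Φ : ℂ → ℂ, IsHat p q f r E φ Φ ∧ IsInverseLaplace q Φ J

end NonlocalEq

end

noncomputable section

open Filter Topology FourierTransform

open scoped SchwartzMap

/-! The core is a Paley–Wiener theorem, `exists_isInverseLaplace`: for `1 < p ≤ 2` every function of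
`H^p` is the Laplace transform of a function in `L^{p'}(0, ∞)`. Applied to the quotient `G` it
yields the candidate `φ`, and injectivity of the Laplace transform (`eq_of_eqOn_laplace`) makes `φ`
the only inverse transform. The zeros of `f` are isolated, so the identity theorem on the half-plane
turns the equation for a solution `ψ` into `L(ψ) = G`; conversely, continuity at the zeros of `f`
shows that `φ` is a solution.

For Paley–Wiener, `G` is multiplied by `regularizer n`, which is bounded by `1` and decays fast
enough to put the product in `H¹`. There the Bromwich integral converges absolutely; Cauchy's
theorem makes it independent of the vertical line (`exp_mul_fourierInv_eq_bromwich`), moving the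
line to infinity kills it for `t < 0`, and Fourier inversion gives `laplace_bromwich`. The
Hausdorff–Young inequality, with some constant, bounds it in `L^{p'}` uniformly in `n`. The limit in
`n` is taken on the line `Re s = 1`.

Hausdorff–Young itself comes from Marcinkiewicz interpolation between the trivial `L¹`–`L^∞` bound
and Plancherel. -/

/-! ### Fourier transform on `L¹` and Plancherel's inequality -/

/-- A locally integrable function on the line that annihilates all Schwartz functions vanishes
almost everywhere. -/
theorem ae_eq_zero_of_integral_schwartz_mul_eq_zero {f : ℝ → ℂ} (hf : LocallyIntegrable f)
    (h : ∀ ψ : 𝓢(ℝ, ℂ), ∫ x, ψ x * f x = 0) : ∀ᵐ x, f x = 0 := by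
  refine ae_eq_zero_of_integral_contDiff_smul_eq_zero hf fun g hg hgc => ?_
  have hg₁ : HasCompactSupport (fun x => (g x : ℂ)) :=
    hgc.comp_left (g := fun t : ℝ => (t : ℂ)) Complex.ofReal_zero
  have hg₂ : ContDiff ℝ (⊤ : ℕ∞) (fun x => (g x : ℂ)) := Complex.ofRealCLM.contDiff.comp hg
  have := h (hg₁.toSchwartzMap hg₂)
  simpa [Complex.real_smul] using this

/-- Multiplication formula for the Fourier transform, against a Schwartz function. -/
theorem integral_schwartz_mul_fourier {f : ℝ → ℂ} (hf : Integrable f) (ψ : 𝓢(ℝ, ℂ)) :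
    ∫ x, ψ x * 𝓕 f x = ∫ x, (𝓕 ψ) x * f x := by
  have := VectorFourier.integral_fourierIntegral_smul_eq_flip (L := innerₗ ℝ) (μ := volume)
    (ν := volume) Real.continuous_fourierChar continuous_inner (ψ.integrable (μ := volume)) hf
  rw [flip_innerₗ] at this
  rw [SchwartzMap.fourier_coe]
  exact this.symm

theorem continuous_fourier_of_integrable {f : ℝ → ℂ} (hf : Integrable f) : Continuous (𝓕 f) :=
  VectorFourier.fourierIntegral_continuous Real.continuous_fourierChar continuous_inner hf

theorem norm_fourier_le_integral_norm (f : ℝ → ℂ) (w : ℝ) : ‖𝓕 f w‖ ≤ ∫ x, ‖f x‖ :=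
  VectorFourier.norm_fourierIntegral_le_integral_norm _ _ _ _ _

/-- The Fourier transform is injective on integrable functions. -/
theorem ae_eq_zero_of_fourier_eq_zero {f : ℝ → ℂ} (hf : Integrable f) (h : ∀ w, 𝓕 f w = 0) :
    ∀ᵐ x, f x = 0 := by
  refine ae_eq_zero_of_integral_schwartz_mul_eq_zero hf.locallyIntegrable fun ψ => ?_
  -- Testing against `𝓕⁻ ψ` makes an arbitrary Schwartz function `ψ` appear on the other side.
  have := integral_schwartz_mul_fourier hf (𝓕⁻ ψ)
  simpa [h] using this.symm

/-- On `L¹ ∩ L²` the Fourier integral is a representative of the `L²` Fourier transform. -/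
theorem coeFn_fourier_toLp_two {f : ℝ → ℂ} (hf : Integrable f) (hf2 : MemLp f 2) :
    (𝓕 (hf2.toLp f) : Lp ℂ 2 (volume : Measure ℝ)) =ᵐ[volume] 𝓕 f := by
  set F := hf2.toLp f
  have hF : LocallyIntegrable (𝓕 F : Lp ℂ 2 (volume : Measure ℝ)) :=
    (Lp.memLp _).locallyIntegrable one_le_two
  have hc := continuous_fourier_of_integrable hf
  have key : ∀ᵐ x, ((𝓕 F : Lp ℂ 2 (volume : Measure ℝ)) - 𝓕 f) x = 0 := by
    refine ae_eq_zero_of_integral_schwartz_mul_eq_zero (hF.sub hc.locallyIntegrable) fun ψ => ?_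
    have h1 : ∫ x, ψ x * (𝓕 F : Lp ℂ 2 (volume : Measure ℝ)) x = ∫ x, ψ x * 𝓕 f x := by
      -- The two transforms are compared as tempered distributions, where both are defined by
      -- duality.
      have h := congrArg (fun T => T ψ) (Lp.fourier_toTemperedDistribution_eq F)
      simp only [TemperedDistribution.fourier_apply, Lp.toTemperedDistribution_apply,
        smul_eq_mul] at h
      rw [← h, integral_schwartz_mul_fourier hf]
      refine integral_congr_ae ?_
      filter_upwards [hf2.coeFn_toLp] with x hx
      rw [hx]
    have i1 : Integrable fun x => ψ x * (𝓕 F : Lp ℂ 2 (volume : Measure ℝ)) x :=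
      (ψ.memLp 2 volume).integrable_mul (Lp.memLp (𝓕 F : Lp ℂ 2 (volume : Measure ℝ)))
    have i2 : Integrable fun x => ψ x * 𝓕 f x :=
      (ψ.integrable).mul_bdd (c := ∫ x, ‖f x‖) hc.aestronglyMeasurable
        (ae_of_all _ (norm_fourier_le_integral_norm f))
    simp only [Pi.sub_apply, mul_sub]
    rw [integral_sub i1 i2, h1, sub_self]
  filter_upwards [key] with x hx using sub_eq_zero.mp hx

/-- Plancherel's inequality for the Fourier integral of an integrable function. -/
theorem lintegral_enorm_fourier_sq_le {f : ℝ → ℂ} (hf : Integrable f) :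
    ∫⁻ w, ‖𝓕 f w‖ₑ ^ 2 ≤ ∫⁻ x, ‖f x‖ₑ ^ 2 := by
  have conv : ∀ g : ℝ → ℂ, eLpNorm g 2 volume ^ 2 = ∫⁻ x, ‖g x‖ₑ ^ 2 := fun g => by
    have := eLpNorm_nnreal_pow_eq_lintegral (μ := volume) (f := g) (p := 2) two_ne_zero
    simpa using this
  rcases eq_or_ne (∫⁻ x, ‖f x‖ₑ ^ 2) ∞ with h | h
  · rw [h]; exact le_top
  have hf2 : MemLp f 2 := by
    refine ⟨hf.1, lt_top_iff_ne_top.2 fun h2 => h ?_⟩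
    rw [← conv, h2]; simp
  have h1 := Lp.norm_fourier_eq (hf2.toLp f)
  rw [Lp.norm_def, Lp.norm_def, eLpNorm_congr_ae (coeFn_fourier_toLp_two hf hf2),
    eLpNorm_congr_ae hf2.coeFn_toLp] at h1
  have h2 : eLpNorm (𝓕 f) 2 volume ≠ ∞ := by
    rw [← eLpNorm_congr_ae (coeFn_fourier_toLp_two hf hf2)]; exact Lp.eLpNorm_ne_top _
  rw [← conv, ← conv, (ENNReal.toReal_eq_toReal_iff' h2 hf2.2.ne).1 h1]

/-! ### Hausdorff–Young inequality by real interpolation -/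

/-- The weak-type step in the Hausdorff–Young inequality: above height `t`, the Fourier transform
is controlled by the `L²` norm of the part of `f` of size at most `(2 N / t) ^ (1 / (p - 1))`, where
`N = ∫ ‖f‖ ^ p`. -/
theorem volume_lt_norm_fourier_le {p : ℝ} (hp : 1 < p) {f : ℝ → ℂ} (hfm : Measurable f)
    (hf : Integrable f) (hfp : Integrable fun x => ‖f x‖ ^ p) (hN : 0 < ∫ x, ‖f x‖ ^ p)
    {t : ℝ} (ht : 0 < t) :
    volume {w | t < ‖𝓕 f w‖} ≤ 4 * ENNReal.ofReal (t ^ (-2 : ℝ)) *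
      ∫⁻ x, {x | t * ‖f x‖ ^ (p - 1) ≤ 2 * ∫ x, ‖f x‖ ^ p}.indicator (fun x => ‖f x‖ₑ ^ 2) x := by
  set N := ∫ x, ‖f x‖ ^ p
  set S := {x | t * ‖f x‖ ^ (p - 1) ≤ 2 * N}
  have hS : MeasurableSet S :=
    measurableSet_le ((hfm.norm.pow_const _).const_mul t) measurable_const
  have i1 := hf.indicator hS
  have i2 := hf.indicator hS.compl
  have hsmall : ∀ w, ‖𝓕 (Sᶜ.indicator f) w‖ ≤ t / 2 := fun w => by
    refine (norm_fourier_le_integral_norm _ w).trans ?_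
    -- Off `S` one has `1 < t / (2 N) * ‖f x‖ ^ (p - 1)`. The cut is chosen so that the large part
    -- has `L¹` norm at most `t / 2`, which leaves at least `t / 2` for the transform of the small
    -- part.
    have : ∀ x, ‖Sᶜ.indicator f x‖ ≤ t / (2 * N) * ‖f x‖ ^ p := fun x => by
      by_cases hx : x ∈ S
      · rw [indicator_of_notMem (by simpa using hx), norm_zero]; positivity
      · rw [indicator_of_mem hx]
        have hx' : 2 * N < t * ‖f x‖ ^ (p - 1) := not_le.1 hx
        have hfx : 0 < ‖f x‖ := by
          refine (norm_nonneg _).lt_of_ne fun h0 => ?_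
          rw [← h0, Real.zero_rpow (by linarith)] at hx'
          linarith
        have e : ‖f x‖ ^ p = ‖f x‖ ^ (p - 1) * ‖f x‖ := by
          rw [← Real.rpow_add_one hfx.ne']; ring_nf
        rw [e, div_mul_eq_mul_div, le_div_iff₀ (by positivity)]
        nlinarith
    calc ∫ x, ‖Sᶜ.indicator f x‖ ≤ ∫ x, t / (2 * N) * ‖f x‖ ^ p :=
          integral_mono i2.norm (hfp.const_mul _) this
      _ = t / 2 := by
          rw [integral_const_mul, show ∫ x, ‖f x‖ ^ p = N from rfl]; field_simp
  have hsum : ∀ w, 𝓕 f w = 𝓕 (S.indicator f) w + 𝓕 (Sᶜ.indicator f) w := fun w => by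
    have := congrFun (VectorFourier.fourierIntegral_add (μ := volume) (L := innerₗ ℝ)
      Real.continuous_fourierChar continuous_inner i1 i2) w
    rw [indicator_self_add_compl] at this
    exact this
  have hsub : {w | t < ‖𝓕 f w‖} ⊆
      {w | ENNReal.ofReal ((t / 2) ^ 2) ≤ ‖𝓕 (S.indicator f) w‖ₑ ^ 2} := fun w hw => by
    have hw' : t < ‖𝓕 f w‖ := hw
    have h1 : t / 2 ≤ ‖𝓕 (S.indicator f) w‖ := by
      have := norm_add_le (𝓕 (S.indicator f) w) (𝓕 (Sᶜ.indicator f) w)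
      rw [← hsum] at this
      linarith [hsmall w]
    change ENNReal.ofReal ((t / 2) ^ 2) ≤ ‖𝓕 (S.indicator f) w‖ₑ ^ 2
    rw [ENNReal.ofReal_pow (by positivity), ← ofReal_norm]
    gcongr
  have hch := mul_meas_ge_le_lintegral (μ := volume)
    ((continuous_fourier_of_integrable i1).measurable.enorm.pow_const 2)
    (ENNReal.ofReal ((t / 2) ^ 2))
  have hc : 4 * ENNReal.ofReal (t ^ (-2 : ℝ)) * ENNReal.ofReal ((t / 2) ^ 2) = 1 := by
    rw [show (4 : ℝ≥0∞) = ENNReal.ofReal 4 by simp, ← ENNReal.ofReal_mul (by norm_num),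
      ← ENNReal.ofReal_mul (by positivity), Real.rpow_neg ht.le, Real.rpow_two]
    rw [← ENNReal.ofReal_one]
    congr 1
    field_simp
    norm_num
  calc volume {w | t < ‖𝓕 f w‖} ≤ _ := measure_mono hsub
    _ = 4 * ENNReal.ofReal (t ^ (-2 : ℝ)) * (ENNReal.ofReal ((t / 2) ^ 2) *
        volume {w | ENNReal.ofReal ((t / 2) ^ 2) ≤ ‖𝓕 (S.indicator f) w‖ₑ ^ 2}) := by
        rw [← mul_assoc, hc, one_mul]
    _ ≤ 4 * ENNReal.ofReal (t ^ (-2 : ℝ)) * ∫⁻ x, ‖S.indicator f x‖ₑ ^ 2 := by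
        gcongr
        exact hch.trans (lintegral_enorm_fourier_sq_le i1)
    _ = _ := by
        congr 2 with x
        by_cases hx : x ∈ S <;> simp [hx]

theorem lintegral_Ioc_rpow {B a : ℝ} (hB : 0 ≤ B) (ha : -1 < a) :
    ∫⁻ t in Ioc 0 B, ENNReal.ofReal (t ^ a) = ENNReal.ofReal (B ^ (a + 1) / (a + 1)) := by
  have hi : IntegrableOn (fun t : ℝ => t ^ a) (Ioc 0 B) :=
    (intervalIntegrable_iff_integrableOn_Ioc_of_le hB).1 (intervalIntegral.intervalIntegrable_rpow' ha)
  rw [← ofReal_integral_eq_lintegral_ofReal hi, ← intervalIntegral.integral_of_le hB,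
    integral_rpow (Or.inl ha), Real.zero_rpow (by linarith), sub_zero]
  filter_upwards [ae_restrict_mem measurableSet_Ioc] with t ht
  exact Real.rpow_nonneg ht.1.le _

/-- Hausdorff–Young inequality, up to a constant, for `1 < p < 2`, by real interpolation. -/
theorem lintegral_norm_fourier_rpow_le {p p' : ℝ} (hp : 1 < p) (hp2 : p < 2)
    (hpp' : 1 / p + 1 / p' = 1) {f : ℝ → ℂ} (hfm : Measurable f)
    (hf : Integrable f) (hfp : Integrable fun x => ‖f x‖ ^ p) (hN : 0 < ∫ x, ‖f x‖ ^ p) :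
    ∫⁻ w, ENNReal.ofReal (‖𝓕 f w‖ ^ p') ≤
      ENNReal.ofReal (4 * p' * 2 ^ (p' - 2) / (p' - 2) * (∫ x, ‖f x‖ ^ p) ^ (p' / p)) := by
  set N := ∫ x, ‖f x‖ ^ p
  have hp0 : 0 < p := by linarith
  have hp'0 : p' ≠ 0 := by
    rintro rfl
    norm_num at hpp'
    linarith
  have hmul : (p - 1) * p' = p := by field_simp at hpp'; linarith
  have hp'2 : 2 < p' := by nlinarith
  have hp' : 0 < p' := by linarith
  -- Layer-cake formula; the weak-type bound is then integrated in `t` and the order of integration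
  -- exchanged.
  rw [lintegral_rpow_eq_lintegral_meas_lt_mul _ (ae_of_all _ fun _ => norm_nonneg _)
    (continuous_fourier_of_integrable hf).norm.aemeasurable hp']
  set K : ℝ → ℝ → ℝ≥0∞ := fun t x => 4 * ENNReal.ofReal (t ^ (p' - 3)) *
    {x | t * ‖f x‖ ^ (p - 1) ≤ 2 * N}.indicator (fun x => ‖f x‖ₑ ^ 2) x
  have hK : Measurable (Function.uncurry K) := by
    refine Measurable.mul (by fun_prop) ?_
    have : MeasurableSet {z : ℝ × ℝ | z.1 * ‖f z.2‖ ^ (p - 1) ≤ 2 * N} :=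
      measurableSet_le (measurable_fst.mul ((hfm.comp measurable_snd).norm.pow_const _))
        measurable_const
    exact ((hfm.comp measurable_snd).enorm.pow_const 2).indicator this
  have step1 : ∫⁻ t in Ioi 0, volume {w | t < ‖𝓕 f w‖} * ENNReal.ofReal (t ^ (p' - 1)) ≤
      ∫⁻ t in Ioi 0, ∫⁻ x, K t x := by
    refine setLIntegral_mono' measurableSet_Ioi fun t (ht : 0 < t) => ?_
    have hm : Measurable fun x => {x | t * ‖f x‖ ^ (p - 1) ≤ 2 * N}.indicator
        (fun x => ‖f x‖ₑ ^ 2) x :=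
      (hfm.enorm.pow_const 2).indicator
        (measurableSet_le ((hfm.norm.pow_const _).const_mul t) measurable_const)
    rw [lintegral_const_mul _ hm]
    refine (mul_le_mul_left (volume_lt_norm_fourier_le hp hfm hf hfp hN ht) _).trans_eq ?_
    have : ENNReal.ofReal (t ^ (p' - 3)) =
        ENNReal.ofReal (t ^ (-2 : ℝ)) * ENNReal.ofReal (t ^ (p' - 1)) := by
      rw [← ENNReal.ofReal_mul (by positivity), ← Real.rpow_add ht]; ring_nf
    rw [this]; ring
  have step2 : ∀ x, ∫⁻ t in Ioi 0, K t x ≤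
      ENNReal.ofReal (4 * 2 ^ (p' - 2) / (p' - 2) * N ^ (p' - 2) * ‖f x‖ ^ p) := fun x => by
    rcases (norm_nonneg (f x)).eq_or_lt with h0 | h0
    · have : ∀ t, K t x = 0 := fun t => by
        simp only [K]
        rw [indicator_apply]
        simp [norm_eq_zero.1 h0.symm]
      simp [this]
    -- For fixed `x`, the height cut in `K` holds only for `t ≤ B`. The remaining integral of `t ^
    -- (p' - 3)` converges at `0` because `p' > 2`.
    set B := 2 * N * ‖f x‖ ^ (1 - p)
    have hB : 0 ≤ B := by positivity
    have hKt : ∀ t ∈ Ioi (0 : ℝ), K t x ≤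
        4 * ‖f x‖ₑ ^ 2 * (Ioc 0 B).indicator (fun t => ENNReal.ofReal (t ^ (p' - 3))) t := by
      intro t ht
      by_cases hx : t * ‖f x‖ ^ (p - 1) ≤ 2 * N
      · have htB : t ≤ B := by
          have : ‖f x‖ ^ (1 - p) = (‖f x‖ ^ (p - 1))⁻¹ := by
            rw [← Real.rpow_neg h0.le]; ring_nf
          simp only [B]
          rwa [this, ← div_eq_mul_inv, le_div_iff₀ (by positivity)]
        rw [indicator_of_mem (show t ∈ Ioc 0 B from ⟨ht, htB⟩)]
        simp only [K]
        rw [indicator_of_mem (by exact hx)]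
        exact le_of_eq (by ring)
      · simp only [K]
        rw [indicator_of_notMem (by exact hx)]
        simp
    calc ∫⁻ t in Ioi 0, K t x ≤ ∫⁻ t in Ioi 0, 4 * ‖f x‖ₑ ^ 2 *
          (Ioc 0 B).indicator (fun t => ENNReal.ofReal (t ^ (p' - 3))) t :=
          setLIntegral_mono' measurableSet_Ioi hKt
      _ ≤ ∫⁻ t, 4 * ‖f x‖ₑ ^ 2 *
          (Ioc 0 B).indicator (fun t => ENNReal.ofReal (t ^ (p' - 3))) t :=
          setLIntegral_le_lintegral _ _
      _ = 4 * ‖f x‖ₑ ^ 2 * ENNReal.ofReal (B ^ (p' - 2) / (p' - 2)) := by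
          rw [lintegral_const_mul _ (Measurable.indicator (by fun_prop) measurableSet_Ioc),
            lintegral_indicator measurableSet_Ioc, lintegral_Ioc_rpow hB (by linarith)]
          ring_nf
      _ = ENNReal.ofReal (4 * 2 ^ (p' - 2) / (p' - 2) * N ^ (p' - 2) * ‖f x‖ ^ p) := by
          rw [show (4 : ℝ≥0∞) = ENNReal.ofReal 4 by simp, ← ofReal_norm,
            ← ENNReal.ofReal_pow h0.le, ← ENNReal.ofReal_mul (by norm_num),
            ← ENNReal.ofReal_mul (by positivity)]
          congr 1
          simp only [B]
          rw [Real.mul_rpow (by positivity) (by positivity), Real.mul_rpow (by norm_num) hN.le,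
            ← Real.rpow_mul h0.le]
          -- From `(p - 1) * p' = p` it follows that `2 + (1 - p) * (p' - 2) = p`.
          have : ‖f x‖ ^ p = ‖f x‖ ^ 2 * ‖f x‖ ^ ((1 - p) * (p' - 2)) := by
            rw [← Real.rpow_two, ← Real.rpow_add h0]
            congr 1
            linarith
          rw [this]
          ring
  calc ENNReal.ofReal p' * ∫⁻ t in Ioi 0, volume {w | t < ‖𝓕 f w‖} * ENNReal.ofReal (t ^ (p' - 1))
      ≤ ENNReal.ofReal p' * ∫⁻ x, ENNReal.ofReal
          (4 * 2 ^ (p' - 2) / (p' - 2) * N ^ (p' - 2) * ‖f x‖ ^ p) := by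
        refine mul_le_mul_right (step1.trans ?_) _
        rw [lintegral_lintegral_swap hK.aemeasurable]
        exact lintegral_mono step2
    _ = _ := by
        have h2 : 0 < p' - 2 := by linarith
        rw [← ofReal_integral_eq_lintegral_ofReal (hfp.const_mul _)
          (ae_of_all _ fun x => by positivity), ← ENNReal.ofReal_mul hp'.le, integral_const_mul]
        congr 1
        have : N ^ (p' / p) = N ^ (p' - 2) * N := by
          rw [← Real.rpow_add_one hN.ne']
          congr 1
          field_simp
          linarith
        rw [this]
        ring

/-- Hausdorff–Young inequality for integrable functions, up to a constant. -/
theorem exists_eLpNorm_fourier_le {p p' : ℝ} (hp : 1 < p) (hp2 : p ≤ 2)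
    (hpp' : 1 / p + 1 / p' = 1) :
    ∃ C : ℝ≥0, ∀ f : ℝ → ℂ, Measurable f → Integrable f → MemLp f (ENNReal.ofReal p) →
      eLpNorm (𝓕 f) (ENNReal.ofReal p') volume ≤ C * eLpNorm f (ENNReal.ofReal p) volume := by
  have hp0 : 0 < p := by linarith
  have hp'0 : p' ≠ 0 := by
    rintro rfl
    norm_num at hpp'
    linarith
  have hmul : (p - 1) * p' = p := by field_simp at hpp'; linarith
  have hp' : 0 < p' := by nlinarith
  have hval : ∀ {q : ℝ}, 0 < q → ∀ g : ℝ → ℂ, eLpNorm g (ENNReal.ofReal q) volume =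
      (∫⁻ x, ENNReal.ofReal (‖g x‖ ^ q)) ^ (1 / q) := fun {q} hq g => by
    rw [eLpNorm_eq_lintegral_rpow_enorm_toReal (by simpa using hq) ENNReal.ofReal_ne_top,
      ENNReal.toReal_ofReal hq.le]
    simp_rw [← ENNReal.ofReal_rpow_of_nonneg (norm_nonneg _) hq.le, ofReal_norm]
  -- At `p = 2` the interpolation constant blows up, and Plancherel applies directly.
  rcases hp2.eq_or_lt with rfl | hlt
  · obtain rfl : p' = 2 := by linarith
    refine ⟨1, fun f _ hf _ => ?_⟩
    rw [hval two_pos, hval two_pos, ENNReal.coe_one, one_mul]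
    have := lintegral_enorm_fourier_sq_le hf
    simp_rw [Real.rpow_two, ENNReal.ofReal_pow (norm_nonneg _), ofReal_norm]
    gcongr
  · have hp'2 : 2 < p' := by nlinarith
    set A := 4 * p' * 2 ^ (p' - 2) / (p' - 2)
    have hA : 0 ≤ A := div_nonneg (by positivity) (by linarith)
    refine ⟨Real.toNNReal (A ^ (1 / p')), fun f hfm hf hfp => ?_⟩
    have hi : Integrable fun x => ‖f x‖ ^ p := by
      simpa [ENNReal.toReal_ofReal hp0.le] using
        hfp.integrable_norm_rpow (by simpa using hp0) ENNReal.ofReal_ne_top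
    have h0 : 0 ≤ ∫ x, ‖f x‖ ^ p := integral_nonneg fun x => by positivity
    rcases h0.eq_or_lt with h0 | h0
    · have : f =ᵐ[volume] 0 := by
        have := (integral_eq_zero_iff_of_nonneg (fun x => by positivity) hi).1 h0.symm
        filter_upwards [this] with x hx
        simpa [Real.rpow_eq_zero (norm_nonneg _) hp0.ne'] using hx
      have h2 : 𝓕 f = 0 := by
        ext w
        rw [Real.fourier_congr_ae this]
        simp [Real.fourier_eq]
      rw [h2, eLpNorm_zero]
      exact zero_le
    rw [hval hp', hval hp0]
    refine (ENNReal.rpow_le_rpow (lintegral_norm_fourier_rpow_le hp hlt hpp' hfm hf hi h0)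
      (by positivity)).trans_eq ?_
    rw [← ofReal_integral_eq_lintegral_ofReal hi (ae_of_all _ fun x => by positivity),
      ENNReal.ofReal_rpow_of_pos h0, ENNReal.ofReal_rpow_of_nonneg (by positivity) (by positivity),
      ENNReal.ofNNReal_toNNReal, ← ENNReal.ofReal_mul (by positivity),
      Real.mul_rpow hA (by positivity), ← Real.rpow_mul h0.le]
    congr 3
    field_simp

theorem fourier_sub_of_integrable {f g : ℝ → ℂ} (hf : Integrable f) (hg : Integrable g) (w : ℝ) :
    𝓕 (f - g) w = 𝓕 f w - 𝓕 g w := by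
  simp only [Real.fourier_eq, Pi.sub_apply, smul_sub]
  exact integral_sub ((Real.fourierIntegral_convergent_iff w).2 hf)
    ((Real.fourierIntegral_convergent_iff w).2 hg)

/-! ### Laplace transform on `L^{p'}(0, ∞)`: analyticity and injectivity -/

namespace NonlocalEq

theorem isOpen_rightHalfPlane : IsOpen RightHalfPlane :=
  isOpen_lt continuous_const Complex.continuous_re

theorem isPreconnected_rightHalfPlane : IsPreconnected RightHalfPlane :=
  (convex_halfSpace_re_gt 0).isPreconnected

theorem holderConjugate_ofReal {p p' : ℝ} (hp : 1 < p) (hpp' : 1 / p + 1 / p' = 1) :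
    p.HolderConjugate p' :=
  Real.holderConjugate_iff.2 ⟨hp, by simpa [one_div] using hpp'⟩

theorem memLp_exp_neg_mul {p b : ℝ} (hp : 0 < p) (hb : 0 < b) :
    MemLp (fun t : ℝ => Real.exp (-b * t)) (ENNReal.ofReal p) (volume.restrict (Ioi 0)) := by
  rw [← integrable_norm_rpow_iff (by fun_prop) (by simpa using hp) ENNReal.ofReal_ne_top,
    ENNReal.toReal_ofReal hp.le]
  have := exp_neg_integrableOn_Ioi 0 (mul_pos hb hp)
  refine this.congr (ae_of_all _ fun t => ?_)
  simp only [Real.norm_eq_abs, Real.abs_exp]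
  rw [← Real.exp_mul]
  ring_nf

/-- The Laplace integral of an `L^{p'}` function converges absolutely on the half-plane. -/
theorem integrableOn_exp_mul {p p' : ℝ} (hpp' : p.HolderConjugate p') {φ : ℝ → ℂ}
    (hφ : MemLp φ (ENNReal.ofReal p') (volume.restrict (Ioi 0))) {s : ℂ} (hs : 0 < s.re) :
    IntegrableOn (fun t : ℝ => Complex.exp (-s * t) * φ t) (Ioi 0) := by
  have : ENNReal.HolderConjugate (ENNReal.ofReal p) (ENNReal.ofReal p') :=
    hpp'.ennrealOfReal
  have h1 : MemLp (fun t : ℝ => Complex.exp (-s * t)) (ENNReal.ofReal p)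
      (volume.restrict (Ioi 0)) := by
    refine (memLp_exp_neg_mul hpp'.pos hs).congr_norm (by fun_prop) (ae_of_all _ fun t => ?_)
    simp [Complex.norm_exp]
  exact h1.integrable_mul hφ

theorem differentiableOn_laplace {φ : ℝ → ℂ}
    (hφ : ∀ s : ℂ, 0 < s.re → IntegrableOn (fun t : ℝ => Complex.exp (-s * t) * φ t) (Ioi 0)) :
    DifferentiableOn ℂ (laplace φ) RightHalfPlane := by
  intro s₀ hs₀
  have hs₀ : 0 < s₀.re := hs₀
  -- Measurability of `φ` is recovered from the integrand at `s = 1` by multiplying with `e^t`.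
  have hm : AEStronglyMeasurable φ (volume.restrict (Ioi 0)) := by
    have h1 := (hφ 1 (by simp)).1
    have h2 : AEStronglyMeasurable (fun t : ℝ => Complex.exp t) (volume.restrict (Ioi 0)) := by
      fun_prop
    refine (h2.mul h1).congr (ae_of_all _ fun t => ?_)
    simp only [Pi.mul_apply]
    rw [← mul_assoc, ← Complex.exp_add]
    simp
  -- On `Re s > 2a` the factor `e^{-2at}` splits in two: one half absorbs the `t` produced by
  -- differentiation, the other keeps the bound integrable.
  set a := s₀.re / 4 with ha
  have ha0 : 0 < a := by positivity
  have hnear : {s : ℂ | 2 * a < s.re} ∈ 𝓝 s₀ :=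
    (isOpen_lt continuous_const Complex.continuous_re).mem_nhds (by
      change 2 * a < s₀.re
      linarith)
  have hderiv := hasDerivAt_integral_of_dominated_loc_of_deriv_le
    (μ := volume.restrict (Ioi (0 : ℝ))) (F := fun s (t : ℝ) => Complex.exp (-s * t) * φ t)
    (F' := fun s (t : ℝ) => -(t : ℂ) * Complex.exp (-s * t) * φ t)
    (bound := fun t => a⁻¹ * ‖Complex.exp (-(a : ℂ) * t) * φ t‖) (x₀ := s₀) hnear
    (Eventually.of_forall fun s => by fun_prop) (hφ s₀ hs₀) (by fun_prop) ?_ ?_ ?_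
  · exact hderiv.2.differentiableAt.differentiableWithinAt
  · filter_upwards [ae_restrict_mem measurableSet_Ioi] with t ht s hs
    have ht : 0 < t := ht
    have hs : 2 * a < s.re := hs
    rw [norm_mul, norm_mul, norm_mul, ← mul_assoc]
    refine mul_le_mul_of_nonneg_right ?_ (norm_nonneg _)
    simp only [Complex.norm_exp, norm_neg, Complex.norm_real, Real.norm_eq_abs, abs_of_pos ht]
    have e1 : (-s * (t : ℂ)).re = -s.re * t := by simp
    have e2 : (-(a : ℂ) * (t : ℂ)).re = -a * t := by simp
    rw [e1, e2]
    have h1 : Real.exp (-s.re * t) ≤ Real.exp (-a * t) * Real.exp (-(a * t)) := by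
      rw [← Real.exp_add]
      exact Real.exp_le_exp.2 (by nlinarith)
    have h2 : t * Real.exp (-(a * t)) ≤ a⁻¹ := by
      have := Real.add_one_le_exp (a * t)
      rw [Real.exp_neg, ← div_eq_mul_inv, div_le_iff₀ (Real.exp_pos _), ← div_eq_inv_mul,
        le_div_iff₀ ha0]
      linarith
    calc t * Real.exp (-s.re * t) ≤ t * (Real.exp (-a * t) * Real.exp (-(a * t))) := by gcongr
      _ = t * Real.exp (-(a * t)) * Real.exp (-a * t) := by ring
      _ ≤ a⁻¹ * Real.exp (-a * t) := by gcongr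
  · exact ((hφ a (by simpa using ha0)).norm).const_mul _
  · refine ae_of_all _ fun t s _ => ?_
    have h1 : HasDerivAt (fun s : ℂ => -s * (t : ℂ)) (-(t : ℂ)) s := by
      simpa using (hasDerivAt_neg s).mul_const (t : ℂ)
    have := (h1.cexp).mul_const (φ t)
    simpa [mul_comm] using this

theorem analyticOnNhd_laplace {p p' : ℝ} (hpp' : p.HolderConjugate p') {φ : ℝ → ℂ}
    (hφ : MemLp φ (ENNReal.ofReal p') (volume.restrict (Ioi 0))) :
    AnalyticOnNhd ℂ (laplace φ) RightHalfPlane :=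
  (differentiableOn_laplace fun _ hs => integrableOn_exp_mul hpp' hφ hs).analyticOnNhd
    isOpen_rightHalfPlane

/-- On vertical lines the Laplace transform is a Fourier transform. -/
theorem fourier_indicator_exp_mul (φ : ℝ → ℂ) (x w : ℝ) :
    𝓕 ((Ioi (0 : ℝ)).indicator fun t : ℝ => Complex.exp (-(x : ℂ) * t) * φ t) w =
      laplace φ (x + (2 * Real.pi * w : ℝ) * Complex.I) := by
  rw [Real.fourier_real_eq_integral_exp_smul, laplace, ← integral_indicator measurableSet_Ioi]
  congr 1 with t
  by_cases ht : t ∈ Ioi (0 : ℝ)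
  · rw [indicator_of_mem ht, indicator_of_mem ht, smul_eq_mul, ← mul_assoc, ← Complex.exp_add]
    congr 2
    push_cast
    ring
  · rw [indicator_of_notMem ht, indicator_of_notMem ht, smul_zero]

/-- The Laplace transform is injective on `L^{p'}(0, ∞)`. -/
theorem eq_of_eqOn_laplace {p p' : ℝ} (hpp' : p.HolderConjugate p') {φ ψ : LpHalfLine p'}
    (h : EqOn (laplace φ) (laplace ψ) RightHalfPlane) : φ = ψ := by
  -- The line `Re s = 1` suffices: on it the Laplace transform is the Fourier transform of an
  -- integrable function.
  have i : ∀ χ : LpHalfLine p', Integrable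
      ((Ioi (0 : ℝ)).indicator fun t : ℝ => Complex.exp (-((1 : ℝ) : ℂ) * t) * χ t) := fun χ =>
    (integrableOn_exp_mul hpp' (Lp.memLp χ) (s := ((1 : ℝ) : ℂ)) (by simp)).integrable_indicator
      measurableSet_Ioi
  have h0 := ae_eq_zero_of_fourier_eq_zero ((i φ).sub (i ψ)) fun w => by
    rw [fourier_sub_of_integrable (i φ) (i ψ), fourier_indicator_exp_mul,
      fourier_indicator_exp_mul, sub_eq_zero]
    exact h (by simp [RightHalfPlane])
  refine Lp.ext ?_
  filter_upwards [ae_restrict_mem measurableSet_Ioi, ae_restrict_of_ae h0] with t ht h0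
  rw [Pi.sub_apply, indicator_of_mem ht, indicator_of_mem ht, ← mul_sub] at h0
  exact sub_eq_zero.1 ((mul_eq_zero.1 h0).resolve_left (Complex.exp_ne_zero _))

/-! ### Contour shifting and the Bromwich integral on `H¹` -/

/-- Cauchy's theorem on a vertical strip: the integral over a vertical line in the half-plane does
not depend on the line, if the `L¹` norms on the vertical lines are bounded. -/
theorem integral_vertical_eq {F : ℂ → ℂ} (hF : DifferentiableOn ℂ F RightHalfPlane) {a b : ℝ}
    (ha : 0 < a) (hab : a ≤ b) {C : ℝ≥0∞} (hC : C ≠ ∞)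
    (hint : ∀ x ∈ Icc a b, ∫⁻ y : ℝ, ‖F (x + y * Complex.I)‖ₑ ≤ C) :
    ∫ y : ℝ, F (a + y * Complex.I) = ∫ y : ℝ, F (b + y * Complex.I) := by
  have hcont : ContinuousOn (fun z : ℝ × ℝ => F (z.1 + z.2 * Complex.I)) (Ioc a b ×ˢ univ) :=
    hF.continuousOn.comp (by fun_prop) fun z hz => by
      have : 0 < z.1 := ha.trans hz.1.1
      simpa [RightHalfPlane] using this
  have hline : ∀ x ∈ Icc a b, Integrable fun y : ℝ => F (x + y * Complex.I) := fun x hx => by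
    refine ⟨Continuous.aestronglyMeasurable ?_, (hint x hx).trans_lt hC.lt_top⟩
    refine hF.continuousOn.comp_continuous (by fun_prop) fun y => ?_
    have : 0 < x := ha.trans_le hx.1
    simpa [RightHalfPlane] using this
  have hprod : Integrable (fun z : ℝ × ℝ => F (z.1 + z.2 * Complex.I))
      ((volume.restrict (Ioc a b)).prod volume) := by
    have hm : AEStronglyMeasurable (fun z : ℝ × ℝ => F (z.1 + z.2 * Complex.I))
        ((volume.restrict (Ioc a b)).prod volume) := by
      have := hcont.aestronglyMeasurable (μ := volume.prod volume)
        (measurableSet_Ioc.prod MeasurableSet.univ)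
      rwa [← Measure.prod_restrict, Measure.restrict_univ] at this
    refine ⟨hm, ?_⟩
    rw [hasFiniteIntegral_iff_enorm, lintegral_prod _ hm.enorm]
    calc _ ≤ ∫⁻ x in Ioc a b, C := setLIntegral_mono' measurableSet_Ioc fun x hx =>
            hint x (Ioc_subset_Icc_self hx)
      _ < ∞ := by
        rw [setLIntegral_const]
        exact ENNReal.mul_lt_top hC.lt_top (by simp)
  -- No pointwise decay on the horizontal sides is available. Instead `H` is integrable by Fubini,
  -- while the rectangle identity gives `H (-T) - H T` a limit; the limit of an integrable function
  -- must be `0`.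
  set H : ℝ → ℂ := fun T => ∫ x in a..b, F (x + T * Complex.I)
  have hH : Integrable H := by
    have := hprod.integral_prod_right
    simpa only [H, intervalIntegral.integral_of_le hab] using this
  have hrect : ∀ T : ℝ, H (-T) - H T = Complex.I * (∫ y in (-T)..T, F (a + y * Complex.I)) -
      Complex.I * ∫ y in (-T)..T, F (b + y * Complex.I) := fun T => by
    have := Complex.integral_boundary_rect_eq_zero_of_differentiableOn F
      ((a : ℂ) + (-T : ℝ) * Complex.I) ((b : ℂ) + (T : ℝ) * Complex.I) (hF.mono fun z hz => by
        have hz := mem_preimage.1 hz.1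
        have : a ≤ z.re := by
          simp only [Complex.add_re, Complex.ofReal_re, Complex.mul_re, Complex.I_re, mul_zero,
            Complex.ofReal_im, Complex.I_im, zero_mul, sub_self, add_zero, uIcc_of_le hab] at hz
          exact hz.1
        exact ha.trans_le this)
    simp only [Complex.add_re, Complex.ofReal_re, Complex.mul_re, Complex.I_re, mul_zero,
      Complex.ofReal_im, Complex.I_im, sub_self, add_zero, Complex.add_im,
      Complex.mul_im, mul_one, zero_add, smul_eq_mul] at this
    linear_combination this
  have hlim : Tendsto (fun T => H (-T) - H T) atTop
      (𝓝 (Complex.I * (∫ y : ℝ, F (a + y * Complex.I)) -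
        Complex.I * ∫ y : ℝ, F (b + y * Complex.I))) := by
    simp_rw [hrect]
    exact ((intervalIntegral_tendsto_integral (hline a (left_mem_Icc.2 hab))
      tendsto_neg_atTop_atBot tendsto_id).const_mul _).sub
      ((intervalIntegral_tendsto_integral (hline b (right_mem_Icc.2 hab))
      tendsto_neg_atTop_atBot tendsto_id).const_mul _)
  have h0 := IntegrableAtFilter.eq_zero_of_tendsto (μ := volume)
    ((hH.comp_neg.sub hH).integrableAtFilter atTop) (fun s hs => by
      obtain ⟨c, hc⟩ := mem_atTop_sets.1 hs
      exact measure_mono_top (s₁ := Ici c) hc Real.volume_Ici) hlim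
  rw [← mul_sub] at h0
  exact sub_eq_zero.1 ((mul_eq_zero.1 h0).resolve_left Complex.I_ne_zero)

/-- The restriction of `Φ` to the vertical line through `x`, in the scaling of the Fourier
transform. -/
def verticalLine (Φ : ℂ → ℂ) (x : ℝ) (y : ℝ) : ℂ := Φ (x + (2 * Real.pi * y : ℝ) * Complex.I)

theorem continuous_verticalLine {Φ : ℂ → ℂ} (hΦ : ContinuousOn Φ RightHalfPlane) {x : ℝ}
    (hx : 0 < x) : Continuous (verticalLine Φ x) :=
  hΦ.comp_continuous (by fun_prop) fun y => by simpa [RightHalfPlane] using hx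

theorem lintegral_comp_two_pi_mul {g : ℝ → ℝ≥0∞} :
    ∫⁻ y : ℝ, g (2 * Real.pi * y) = ENNReal.ofReal (1 / (2 * Real.pi)) * ∫⁻ y, g y := by
  have h := Real.map_volume_mul_left (a := 2 * Real.pi) (by positivity)
  have h2 := (Homeomorph.mulLeft₀ (2 * Real.pi) (by positivity)).measurableEmbedding.lintegral_map
    (μ := volume) g
  rw [Homeomorph.coe_mulLeft₀, h, lintegral_smul_measure, smul_eq_mul] at h2
  rw [← h2, abs_of_pos (by positivity), one_div]

/-- The mean of order `q` is the `L^q` norm of the restriction to the vertical line. -/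
theorem hardyMean_eq_eLpNorm {q : ℝ} (hq : 0 < q) (Φ : ℂ → ℂ) (x : ℝ) :
    hardyMean q Φ x = eLpNorm (verticalLine Φ x) (ENNReal.ofReal q) volume := by
  rw [eLpNorm_eq_lintegral_rpow_enorm_toReal (by simpa using hq) ENNReal.ofReal_ne_top,
    ENNReal.toReal_ofReal hq.le, hardyMean]
  congr 1
  exact (lintegral_comp_two_pi_mul (g := fun y => ‖Φ (x + y * Complex.I)‖ₑ ^ q)).symm

/-- The inverse Laplace transform of a function in `H¹`, computed on the line `Re s = 1`. -/
def bromwich (K : ℂ → ℂ) (t : ℝ) : ℂ := Complex.exp t * 𝓕⁻ (verticalLine K 1) t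

theorem integrable_verticalLine {K : ℂ → ℂ} (hK : DifferentiableOn ℂ K RightHalfPlane) {C : ℝ≥0}
    (hC : ∀ x : ℝ, 0 < x → eLpNorm (verticalLine K x) 1 volume ≤ C) {x : ℝ} (hx : 0 < x) :
    Integrable (verticalLine K x) :=
  memLp_one_iff_integrable.1 ⟨(continuous_verticalLine hK.continuousOn hx).aestronglyMeasurable,
    (hC x hx).trans_lt ENNReal.coe_lt_top⟩

/-- The substitution by `2π` exhibits a contour integral of `K(s) e^{st}`, analytic in `s`, to which
Cauchy's theorem applies. -/
theorem exp_mul_fourierInv_verticalLine (K : ℂ → ℂ) (x t : ℝ) :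
    Complex.exp (x * t) * 𝓕⁻ (verticalLine K x) t = (1 / (2 * Real.pi) : ℝ) *
      ∫ y : ℝ, K (x + y * Complex.I) * Complex.exp ((x + y * Complex.I) * t) := by
  have h := Measure.integral_comp_mul_left
    (fun y : ℝ => K (x + y * Complex.I) * Complex.exp ((x + y * Complex.I) * t)) (2 * Real.pi)
  rw [abs_of_pos (by positivity), ← one_div, Complex.real_smul] at h
  rw [← h, Real.fourierInv_eq', ← integral_const_mul]
  congr 1 with y
  rw [smul_eq_mul, verticalLine, mul_left_comm, ← mul_assoc, ← Complex.exp_add, mul_comm]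
  congr 2
  simp only [RCLike.inner_apply, conj_trivial]
  push_cast
  ring

/-- On a strip with right edge `b` the factor `e^{st}` is bounded by `e^{b|t|}`, so `K(s) e^{st}`
inherits the uniform `L¹` bounds that contour shifting requires. -/
theorem exp_mul_fourierInv_eq_bromwich {K : ℂ → ℂ} (hK : DifferentiableOn ℂ K RightHalfPlane)
    {C : ℝ≥0} (hC : ∀ x : ℝ, 0 < x → eLpNorm (verticalLine K x) 1 volume ≤ C) {x : ℝ} (hx : 0 < x)
    (t : ℝ) : Complex.exp (x * t) * 𝓕⁻ (verticalLine K x) t = bromwich K t := by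
  have main : ∀ a b : ℝ, 0 < a → a ≤ b → Complex.exp (a * t) * 𝓕⁻ (verticalLine K a) t =
      Complex.exp (b * t) * 𝓕⁻ (verticalLine K b) t := fun a b ha hab => by
    rw [exp_mul_fourierInv_verticalLine, exp_mul_fourierInv_verticalLine]
    congr 1
    refine integral_vertical_eq (F := fun s => K s * Complex.exp (s * t))
      (hK.mul (by fun_prop)) ha hab
      (C := ENNReal.ofReal (2 * Real.pi) * C * ENNReal.ofReal (Real.exp (b * |t|)))
      (by finiteness) fun x hx => ?_
    have hx0 : 0 < x := ha.trans_le hx.1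
    have hpt : ∀ y : ℝ, ‖K (x + y * Complex.I) * Complex.exp ((x + y * Complex.I) * t)‖ₑ ≤
        ‖K (x + y * Complex.I)‖ₑ * ENNReal.ofReal (Real.exp (b * |t|)) := fun y => by
      rw [enorm_mul]
      gcongr
      rw [← ofReal_norm, Complex.norm_exp]
      refine ENNReal.ofReal_le_ofReal (Real.exp_le_exp.2 ?_)
      have : (((x : ℂ) + y * Complex.I) * t).re = x * t := by simp
      rw [this]
      calc x * t ≤ x * |t| := by gcongr; exact le_abs_self t
        _ ≤ b * |t| := by gcongr; exact hx.2
    refine (lintegral_mono hpt).trans ?_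
    rw [lintegral_mul_const' _ _ ENNReal.ofReal_ne_top]
    gcongr
    have h1 := hC x hx0
    rw [eLpNorm_one_eq_lintegral_enorm] at h1
    have h2 : ∫⁻ y, ‖verticalLine K x y‖ₑ = _ :=
      lintegral_comp_two_pi_mul (g := fun y => ‖K (x + y * Complex.I)‖ₑ)
    rw [h2] at h1
    calc ∫⁻ y : ℝ, ‖K (x + y * Complex.I)‖ₑ = ENNReal.ofReal (2 * Real.pi) *
          (ENNReal.ofReal (1 / (2 * Real.pi)) * ∫⁻ y : ℝ, ‖K (x + y * Complex.I)‖ₑ) := by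
          rw [← mul_assoc, ← ENNReal.ofReal_mul (by positivity),
            mul_one_div_cancel (by positivity), ENNReal.ofReal_one, one_mul]
      _ ≤ _ := by gcongr
  have h1 : Complex.exp ((1 : ℝ) * t) * 𝓕⁻ (verticalLine K 1) t = bromwich K t := by
    simp [bromwich]
  rw [← h1]
  rcases le_total x 1 with h | h
  · exact main x 1 hx h
  · exact (main 1 x one_pos h).symm

theorem norm_fourierInv_le_integral_norm (f : ℝ → ℂ) (w : ℝ) : ‖𝓕⁻ f w‖ ≤ ∫ x, ‖f x‖ := by
  rw [Real.fourierInv_eq_fourier_neg]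
  exact norm_fourier_le_integral_norm f _

/-- The freedom in `x` is the point: `x → ∞` gives vanishing for `t < 0`, and small `x` gives
convergence of the Laplace integral. -/
theorem norm_bromwich_le {K : ℂ → ℂ} (hK : DifferentiableOn ℂ K RightHalfPlane)
    {C : ℝ≥0} (hC : ∀ x : ℝ, 0 < x → eLpNorm (verticalLine K x) 1 volume ≤ C) {x : ℝ} (hx : 0 < x)
    (t : ℝ) : ‖bromwich K t‖ ≤ Real.exp (x * t) * C := by
  rw [← exp_mul_fourierInv_eq_bromwich hK hC hx, norm_mul, Complex.norm_exp]
  have : ((x : ℂ) * t).re = x * t := by simp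
  rw [this]
  gcongr
  refine (norm_fourierInv_le_integral_norm _ t).trans ?_
  have h1 := hC x hx
  rw [eLpNorm_one_eq_lintegral_enorm] at h1
  rw [integral_norm_eq_lintegral_enorm
    (continuous_verticalLine hK.continuousOn hx).aestronglyMeasurable]
  exact ENNReal.toReal_le_coe_of_le_coe h1

theorem bromwich_eq_zero {K : ℂ → ℂ} (hK : DifferentiableOn ℂ K RightHalfPlane)
    {C : ℝ≥0} (hC : ∀ x : ℝ, 0 < x → eLpNorm (verticalLine K x) 1 volume ≤ C) {t : ℝ} (ht : t < 0) :
    bromwich K t = 0 := by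
  have h1 : Tendsto (fun x : ℝ => Real.exp (x * t) * C) atTop (𝓝 (0 * C)) :=
    (Real.tendsto_exp_atBot.comp (tendsto_id.atTop_mul_const_of_neg ht)).mul_const _
  have h2 := ge_of_tendsto h1 (by
    filter_upwards [eventually_gt_atTop 0] with x hx using norm_bromwich_le hK hC hx t)
  rw [zero_mul] at h2
  exact norm_le_zero_iff.1 h2

theorem continuous_bromwich {K : ℂ → ℂ} (hK : DifferentiableOn ℂ K RightHalfPlane)
    {C : ℝ≥0} (hC : ∀ x : ℝ, 0 < x → eLpNorm (verticalLine K x) 1 volume ≤ C) :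
    Continuous (bromwich K) := by
  have h := continuous_fourier_of_integrable (integrable_verticalLine hK hC one_pos)
  have h' : Continuous (𝓕⁻ (verticalLine K 1)) := by
    have : 𝓕⁻ (verticalLine K 1) = fun t => 𝓕 (verticalLine K 1) (-t) :=
      funext fun t => Real.fourierInv_eq_fourier_neg _ t
    rw [this]
    exact h.comp continuous_neg
  exact (by fun_prop : Continuous fun t : ℝ => Complex.exp t).mul h'

/-- The Laplace transform inverts the Bromwich integral on `H¹`. -/
theorem laplace_bromwich {K : ℂ → ℂ} (hK : DifferentiableOn ℂ K RightHalfPlane)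
    {C : ℝ≥0} (hC : ∀ x : ℝ, 0 < x → eLpNorm (verticalLine K x) 1 volume ≤ C) :
    EqOn (laplace (bromwich K)) K RightHalfPlane := by
  intro s hs
  have hs : 0 < s.re := hs
  set x := s.re with hx
  have hInv : 𝓕⁻ (verticalLine K x) =ᵐ[volume]
      (Ioi (0 : ℝ)).indicator fun t : ℝ => Complex.exp (-(x : ℂ) * t) * bromwich K t := by
    -- The point `t = 0` is discarded, since vanishing is known only for `t < 0`.
    filter_upwards [compl_mem_ae_iff.2 (measure_singleton (0 : ℝ))] with t ht
    have e : 𝓕⁻ (verticalLine K x) t = Complex.exp (-(x : ℂ) * t) * bromwich K t := by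
      rw [← exp_mul_fourierInv_eq_bromwich hK hC hs, ← mul_assoc, ← Complex.exp_add]
      simp
    rcases lt_or_gt_of_ne (show t ≠ 0 from ht) with h | h
    · rw [indicator_of_notMem (by simpa using h.le), e, bromwich_eq_zero hK hC h, mul_zero]
    · rw [indicator_of_mem (by exact h), e]
  have hi : Integrable ((Ioi (0 : ℝ)).indicator
      fun t : ℝ => Complex.exp (-(x : ℂ) * t) * bromwich K t) := by
    rw [integrable_indicator_iff measurableSet_Ioi]
    -- The growth bound is used at `x / 2`, so that `e^{-xt} e^{xt/2}` still decays.
    have hb := ((exp_neg_integrableOn_Ioi 0 (half_pos hs)).mul_const (C : ℝ))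
    refine Integrable.mono' hb ?_ (ae_of_all _ fun t => ?_)
    · have := continuous_bromwich hK hC
      exact Continuous.aestronglyMeasurable (by fun_prop)
    · rw [norm_mul, Complex.norm_exp]
      have e : (-(x : ℂ) * t).re = -x * t := by simp
      rw [e]
      calc Real.exp (-x * t) * ‖bromwich K t‖
          ≤ Real.exp (-x * t) * (Real.exp (x / 2 * t) * C) := by
            gcongr
            exact norm_bromwich_le hK hC (half_pos hs) t
        _ = Real.exp (-(x / 2) * t) * C := by
            rw [← mul_assoc, ← Real.exp_add]
            ring_nf
  have hF : Integrable (𝓕 (verticalLine K x)) := by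
    refine ((integrable_congr hInv).2 hi).comp_neg.congr (ae_of_all _ fun w => ?_)
    simp only [Real.fourierInv_eq_fourier_neg, neg_neg]
  have h1 := congrFun ((continuous_verticalLine hK.continuousOn hs).fourier_fourierInv_eq
    (integrable_verticalLine hK hC hs) hF) (s.im / (2 * Real.pi))
  rw [Real.fourier_congr_ae hInv, fourier_indicator_exp_mul, verticalLine] at h1
  have e : (x : ℂ) + (2 * Real.pi * (s.im / (2 * Real.pi)) : ℝ) * Complex.I = s := by
    rw [mul_div_cancel₀ _ (by positivity), hx, Complex.re_add_im]
  rwa [e] at h1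

end NonlocalEq

/-! ### `L^p` estimates for the inverse transform -/

theorem fourierInv_eq_fourier_comp_neg_apply (f : ℝ → ℂ) : 𝓕⁻ f = 𝓕 f ∘ fun t => -t :=
  funext fun t => Real.fourierInv_eq_fourier_neg f t

/-- Hausdorff–Young inequality for the inverse Fourier transform, up to a constant. -/
theorem exists_eLpNorm_fourierInv_le {p p' : ℝ} (hp : 1 < p) (hp2 : p ≤ 2)
    (hpp' : 1 / p + 1 / p' = 1) :
    ∃ C : ℝ≥0, ∀ f : ℝ → ℂ, Measurable f → Integrable f → MemLp f (ENNReal.ofReal p) →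
      eLpNorm (𝓕⁻ f) (ENNReal.ofReal p') volume ≤ C * eLpNorm f (ENNReal.ofReal p) volume := by
  obtain ⟨C, hC⟩ := exists_eLpNorm_fourier_le hp hp2 hpp'
  refine ⟨C, fun f hfm hf hfp => (hC f hfm hf hfp).trans' (le_of_eq ?_)⟩
  rw [fourierInv_eq_fourier_comp_neg_apply]
  exact eLpNorm_comp_measurePreserving
    (continuous_fourier_of_integrable hf).aestronglyMeasurable (Measure.measurePreserving_neg volume)

theorem fourierInv_sub_of_integrable {f g : ℝ → ℂ} (hf : Integrable f) (hg : Integrable g) :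
    𝓕⁻ (f - g) = 𝓕⁻ f - 𝓕⁻ g := by
  ext t
  simp only [Pi.sub_apply, Real.fourierInv_eq_fourier_neg]
  exact fourier_sub_of_integrable hf hg _

/-- Dominated convergence to zero in `L^p`. -/
theorem tendsto_eLpNorm_zero_of_dominated {α : Type*} [MeasurableSpace α] {μ : Measure α} {p : ℝ}
    (hp : 0 < p) {F : ℕ → α → ℂ} {g : α → ℂ} (hF : ∀ n, AEStronglyMeasurable (F n) μ)
    (hg : MemLp g (ENNReal.ofReal p) μ) (hle : ∀ n x, ‖F n x‖ ≤ ‖g x‖)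
    (hlim : ∀ x, Tendsto (fun n => F n x) atTop (𝓝 0)) :
    Tendsto (fun n => eLpNorm (F n) (ENNReal.ofReal p) μ) atTop (𝓝 0) := by
  have hval : ∀ h : α → ℂ, eLpNorm h (ENNReal.ofReal p) μ = (∫⁻ x, ‖h x‖ₑ ^ p ∂μ) ^ (1 / p) :=
    fun h => by
      rw [eLpNorm_eq_lintegral_rpow_enorm_toReal (by simpa using hp) ENNReal.ofReal_ne_top,
        ENNReal.toReal_ofReal hp.le]
  have hfin : ∫⁻ x, ‖g x‖ₑ ^ p ∂μ ≠ ∞ := by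
    have := (lintegral_rpow_enorm_lt_top_of_eLpNorm_lt_top (by simpa using hp)
      ENNReal.ofReal_ne_top hg.2).ne
    rwa [ENNReal.toReal_ofReal hp.le] at this
  have h := tendsto_lintegral_of_dominated_convergence' (μ := μ) (fun x => ‖g x‖ₑ ^ p)
    (fun n => ((hF n).enorm.pow_const p)) (f := fun _ => 0)
    (fun n => ae_of_all _ fun x => ENNReal.rpow_le_rpow (enorm_le_iff_norm_le.2 (hle n x)) hp.le) hfin
    (ae_of_all _ fun x => by
      have := ((ENNReal.continuous_rpow_const (y := p)).tendsto _).comp ((hlim x).enorm)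
      simpa [hp, Function.comp_def] using this)
  simp_rw [hval]
  have h2 := ((ENNReal.continuous_rpow_const (y := 1 / p)).tendsto _).comp h
  simpa [hp, Function.comp_def] using h2

namespace NonlocalEq

/-- The `L^{p'}` norm of the Bromwich integral is controlled by the `H^p` norm. -/
theorem eLpNorm_bromwich_le {p q : ℝ} {A : ℝ≥0}
    (hA : ∀ f : ℝ → ℂ, Measurable f → Integrable f → MemLp f (ENNReal.ofReal p) →
      eLpNorm (𝓕⁻ f) (ENNReal.ofReal q) volume ≤ A * eLpNorm f (ENNReal.ofReal p) volume)
    {K : ℂ → ℂ} (hK : DifferentiableOn ℂ K RightHalfPlane) {C : ℝ≥0}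
    (hC : ∀ x : ℝ, 0 < x → eLpNorm (verticalLine K x) 1 volume ≤ C) {B : ℝ≥0}
    (hB : ∀ x : ℝ, 0 < x → eLpNorm (verticalLine K x) (ENNReal.ofReal p) volume ≤ B) :
    eLpNorm (bromwich K) (ENNReal.ofReal q) volume ≤ A * B := by
  have hcont := continuous_bromwich hK hC
  have hpos : ∀ n : ℕ, (0 : ℝ) < 1 / (n + 1) := fun n => Nat.one_div_pos_of_nat
  have heq : ∀ n : ℕ, 𝓕⁻ (verticalLine K (1 / (n + 1))) =
      fun t : ℝ => Complex.exp (-((1 / (n + 1) : ℝ) : ℂ) * t) * bromwich K t := fun n => by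
    ext t
    rw [← exp_mul_fourierInv_eq_bromwich hK hC (hpos n), ← mul_assoc, ← Complex.exp_add]
    simp
  -- Fatou as the line `Re s = 1 / (n + 1)` approaches the imaginary axis: Hausdorff–Young bounds
  -- `e^{-xt} bromwich K t` uniformly in `x`.
  refine Lp.eLpNorm_le_of_ae_tendsto (u := atTop)
    (f := fun n : ℕ => 𝓕⁻ (verticalLine K (1 / (n + 1)))) (Eventually.of_forall fun n => ?_)
    (fun n => ?_) (ae_of_all _ fun t => ?_)
  · have hc := continuous_verticalLine hK.continuousOn (hpos n)
    refine (hA _ hc.measurable (integrable_verticalLine hK hC (hpos n))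
      ⟨hc.aestronglyMeasurable, (hB _ (hpos n)).trans_lt ENNReal.coe_lt_top⟩).trans ?_
    gcongr
    exact hB _ (hpos n)
  · rw [heq]
    exact Continuous.aestronglyMeasurable (by fun_prop)
  · simp_rw [heq]
    have h1 : Tendsto (fun n : ℕ => ((1 / (n + 1) : ℝ) : ℂ)) atTop (𝓝 ((0 : ℝ) : ℂ)) :=
      (Complex.continuous_ofReal.tendsto _).comp tendsto_one_div_add_atTop_nhds_zero_nat
    have h2 : Continuous fun z : ℂ => Complex.exp (-z * t) * bromwich K t := by fun_prop
    have := (h2.tendsto _).comp h1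
    simpa [Function.comp_def] using this

/-! ### Regularization and the Paley–Wiener theorem -/

/-- Multipliers tending to `1` that turn functions in `H^p` into functions in `H¹`. -/
def regularizer (n : ℕ) (s : ℂ) : ℂ := ((1 + s / (n + 1)) ^ 2)⁻¹

/-- Since `Re s > 0`, the real part of `1 + s / (n + 1)` exceeds `1`. The bound is free of `Re s`,
hence serves all vertical lines at once. -/
theorem sq_le_norm_one_add_div_sq (n : ℕ) {s : ℂ} (hs : 0 < s.re) :
    1 + (s.im / (n + 1)) ^ 2 ≤ ‖(1 + s / (n + 1)) ^ 2‖ := by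
  rw [norm_pow, ← Complex.normSq_eq_norm_sq, Complex.normSq_apply]
  have e : s / ((n : ℂ) + 1) = s / ((n + 1 : ℝ) : ℂ) := by push_cast; rfl
  have hre : (1 + s / ((n : ℂ) + 1)).re = 1 + s.re / (n + 1) := by
    rw [e, Complex.add_re, Complex.div_ofReal_re, Complex.one_re]
  have him : (1 + s / ((n : ℂ) + 1)).im = s.im / (n + 1) := by
    rw [e, Complex.add_im, Complex.div_ofReal_im, Complex.one_im, zero_add]
  rw [hre, him]
  have : 0 < s.re / (n + 1) := by positivity
  nlinarith

theorem norm_regularizer_le (n : ℕ) {s : ℂ} (hs : 0 < s.re) :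
    ‖regularizer n s‖ ≤ (1 + (s.im / (n + 1)) ^ 2)⁻¹ := by
  rw [regularizer, norm_inv]
  exact inv_anti₀ (by positivity) (sq_le_norm_one_add_div_sq n hs)

theorem norm_regularizer_le_one (n : ℕ) {s : ℂ} (hs : 0 < s.re) : ‖regularizer n s‖ ≤ 1 :=
  (norm_regularizer_le n hs).trans (inv_le_one_of_one_le₀ (by nlinarith [sq_nonneg (s.im / (n + 1))]))

theorem differentiableOn_regularizer (n : ℕ) :
    DifferentiableOn ℂ (regularizer n) RightHalfPlane := by
  refine DifferentiableOn.inv (by fun_prop) fun s hs => ?_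
  rw [← norm_pos_iff]
  exact (sq_le_norm_one_add_div_sq n hs).trans_lt' (by positivity)

theorem tendsto_regularizer (s : ℂ) : Tendsto (fun n => regularizer n s) atTop (𝓝 1) := by
  have h1 : Tendsto (fun n : ℕ => ((1 / (n + 1) : ℝ) : ℂ)) atTop (𝓝 ((0 : ℝ) : ℂ)) :=
    (Complex.continuous_ofReal.tendsto _).comp tendsto_one_div_add_atTop_nhds_zero_nat
  have h2 : ContinuousAt (fun z : ℂ => ((1 + s * z) ^ 2)⁻¹) ((0 : ℝ) : ℂ) :=
    ContinuousAt.inv₀ (by fun_prop) (by simp)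
  have := h2.tendsto.comp h1
  simpa [regularizer, Function.comp_def, div_eq_mul_inv] using this

/-- The majorant `(1 + (c y)²)⁻¹` does not depend on `x`; being at most `1` and integrable, it lies
in every `L^q` with `q ≥ 1`. -/
theorem exists_eLpNorm_verticalLine_regularizer_le {q : ℝ} (hq : 1 ≤ q) (n : ℕ) :
    ∃ M : ℝ≥0, ∀ x : ℝ, 0 < x →
      eLpNorm (verticalLine (regularizer n) x) (ENNReal.ofReal q) volume ≤ M := by
  have hq0 : 0 < q := by linarith
  set c : ℝ := 2 * Real.pi / (n + 1)
  have hc : c ≠ 0 := by positivity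
  have hmem : MemLp (fun y : ℝ => (1 + (c * y) ^ 2)⁻¹) (ENNReal.ofReal q) volume := by
    have hcont : Continuous fun y : ℝ => (1 + (c * y) ^ 2)⁻¹ :=
      Continuous.inv₀ (by fun_prop) fun y => by positivity
    rw [← integrable_norm_rpow_iff hcont.aestronglyMeasurable (by simpa using hq0)
      ENNReal.ofReal_ne_top, ENNReal.toReal_ofReal hq0.le]
    refine ((integrable_inv_one_add_sq.comp_mul_left' hc)).mono'
      (hcont.norm.rpow_const fun _ => Or.inr hq0.le).aestronglyMeasurable (ae_of_all _ fun y => ?_)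
    have h0 : 0 ≤ (1 + (c * y) ^ 2)⁻¹ := by positivity
    have h1 : (1 + (c * y) ^ 2)⁻¹ ≤ 1 := inv_le_one_of_one_le₀ (by nlinarith [sq_nonneg (c * y)])
    rw [Real.norm_of_nonneg h0, Real.norm_of_nonneg (by positivity)]
    calc ((1 + (c * y) ^ 2)⁻¹) ^ q ≤ ((1 + (c * y) ^ 2)⁻¹) ^ (1 : ℝ) :=
          Real.rpow_le_rpow_of_exponent_ge' h0 h1 zero_le_one hq
      _ = _ := Real.rpow_one _
  refine ⟨(eLpNorm (fun y : ℝ => (1 + (c * y) ^ 2)⁻¹) (ENNReal.ofReal q) volume).toNNReal,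
    fun x hx => ?_⟩
  rw [ENNReal.coe_toNNReal hmem.2.ne]
  refine eLpNorm_mono_real fun y => ?_
  refine (norm_regularizer_le n (by simpa using hx)).trans_eq ?_
  simp only [Complex.add_im, Complex.ofReal_im, Complex.mul_im, Complex.ofReal_re, Complex.I_im,
    Complex.I_re, c]
  ring_nf

/-- Paley–Wiener theorem for `H^p`, `1 < p ≤ 2`: every function in `H^p` of the right half-plane is
the Laplace transform of a function in `L^{p'}(0, ∞)`. -/
theorem exists_isInverseLaplace {p p' : ℝ} (hp : 1 < p) (hp2 : p ≤ 2) (hpp' : 1 / p + 1 / p' = 1)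
    {G : ℂ → ℂ} (hG : MemHardy p G) : ∃ φ : LpHalfLine p', IsInverseLaplace p' G φ := by
  obtain ⟨hGa, B, hB⟩ := hG
  have hconj := holderConjugate_ofReal hp hpp'
  have hp0 : 0 < p := hconj.pos
  have hp'1 : 1 < p' := hconj.symm.lt
  have hp'0 : 0 < p' := hconj.symm.pos
  have hE : ENNReal.HolderConjugate (ENNReal.ofReal p) (ENNReal.ofReal p') := hconj.ennrealOfReal
  have : Fact (1 ≤ ENNReal.ofReal p') := ⟨by simpa using hp'1.le⟩
  have hp'ne : ENNReal.ofReal p' ≠ 0 := by simpa using hp'0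
  simp_rw [hardyMean_eq_eLpNorm hp0] at hB
  obtain ⟨A, hA⟩ := exists_eLpNorm_fourierInv_le hp hp2 hpp'
  have hGd : DifferentiableOn ℂ G RightHalfPlane := hGa.differentiableOn
  set K : ℕ → ℂ → ℂ := fun n s => regularizer n s * G s
  have hK : ∀ n, DifferentiableOn ℂ (K n) RightHalfPlane := fun n =>
    (differentiableOn_regularizer n).mul hGd
  have hline : ∀ (y : ℝ) {x : ℝ}, 0 < x →
      0 < ((x : ℂ) + (2 * Real.pi * y : ℝ) * Complex.I).re := fun y x hx => by simpa using hx
  have hKB : ∀ n, ∀ x : ℝ, 0 < x →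
      eLpNorm (verticalLine (K n) x) (ENNReal.ofReal p) volume ≤ B := fun n x hx => by
    refine (eLpNorm_mono fun y => ?_).trans (hB x hx)
    simp only [verticalLine, K, norm_mul]
    exact mul_le_of_le_one_left (norm_nonneg _) (norm_regularizer_le_one n (hline y hx))
  have hK1 : ∀ n, ∃ C : ℝ≥0, ∀ x : ℝ, 0 < x → eLpNorm (verticalLine (K n) x) 1 volume ≤ C :=
    fun n => by
      obtain ⟨M, hM⟩ := exists_eLpNorm_verticalLine_regularizer_le hp'1.le n
      refine ⟨M * B, fun x hx => ?_⟩
      -- Hölder with exponents `p'` and `p` puts `K n` in `H¹`.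
      have h := eLpNorm_smul_le_mul_eLpNorm (p := ENNReal.ofReal p') (q := ENNReal.ofReal p)
        (r := 1) (μ := volume) (f := verticalLine G x) (φ := verticalLine (regularizer n) x)
        (continuous_verticalLine hGd.continuousOn hx).aestronglyMeasurable
        (continuous_verticalLine (differentiableOn_regularizer n).continuousOn
          hx).aestronglyMeasurable
      refine h.trans ?_
      rw [ENNReal.coe_mul]
      exact mul_le_mul' (hM x hx) (hB x hx)
  choose C hC using hK1
  -- the restrictions to the line `Re s = 1`, and their Fourier transforms
  set g : ℕ → ℝ → ℂ := fun n => verticalLine (K n) 1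
  set g₀ : ℝ → ℂ := verticalLine G 1
  have hgc : ∀ n, Continuous (g n) := fun n => continuous_verticalLine (hK n).continuousOn one_pos
  have hg₀c : Continuous g₀ := continuous_verticalLine hGd.continuousOn one_pos
  have hgi : ∀ n, Integrable (g n) := fun n => integrable_verticalLine (hK n) (hC n) one_pos
  have hgL : ∀ n, MemLp (g n) (ENNReal.ofReal p) := fun n =>
    ⟨(hgc n).aestronglyMeasurable, (hKB n 1 one_pos).trans_lt ENNReal.coe_lt_top⟩
  have hg₀L : MemLp g₀ (ENNReal.ofReal p) :=
    ⟨hg₀c.aestronglyMeasurable, (hB 1 one_pos).trans_lt ENNReal.coe_lt_top⟩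
  have hglim : Tendsto (fun n => eLpNorm (g n - g₀) (ENNReal.ofReal p) volume) atTop (𝓝 0) := by
    refine tendsto_eLpNorm_zero_of_dominated hp0 (g := fun y => (2 : ℂ) * g₀ y)
      (fun n => ((hgc n).sub hg₀c).aestronglyMeasurable) (hg₀L.const_mul 2) (fun n y => ?_)
      (fun y => ?_)
    · have e : (g n - g₀) y = (regularizer n (((1 : ℝ) : ℂ) +
          (2 * Real.pi * y : ℝ) * Complex.I) - 1) * g₀ y := by
        simp only [g, g₀, verticalLine, K, Pi.sub_apply]
        ring
      rw [e, norm_mul, norm_mul]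
      refine mul_le_mul_of_nonneg_right ((norm_sub_le _ _).trans ?_) (norm_nonneg _)
      have := norm_regularizer_le_one n (hline y one_pos)
      rw [norm_one, Complex.norm_ofNat]
      linarith
    · have := ((tendsto_regularizer (((1 : ℝ) : ℂ) +
        (2 * Real.pi * y : ℝ) * Complex.I)).mul_const (g₀ y)).sub_const (g₀ y)
      rw [one_mul, sub_self] at this
      exact this
  set u : ℕ → ℝ → ℂ := fun n => 𝓕⁻ (g n)
  have hubr : ∀ n t, bromwich (K n) t = Complex.exp t * u n t := fun n t => rfl
  have huc : ∀ n, Continuous (u n) := fun n => by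
    simp only [u, fourierInv_eq_fourier_comp_neg_apply]
    exact (continuous_fourier_of_integrable (hgi n)).comp continuous_neg
  have huL : ∀ n, MemLp (u n) (ENNReal.ofReal p') := fun n =>
    ⟨(huc n).aestronglyMeasurable, (hA _ (hgc n).measurable (hgi n) (hgL n)).trans_lt
      (ENNReal.mul_lt_top ENNReal.coe_lt_top (hgL n).2)⟩
  -- `g₀` need not be integrable, so its inverse transform is obtained as the `L^{p'}` limit of the
  -- `u n`, which is Cauchy by Hausdorff–Young.
  have hucauchy : CauchySeq fun n => (huL n).toLp (u n) := by
    rw [Lp.cauchySeq_Lp_iff_cauchySeq_eLpNorm]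
    have hbound : ∀ N : ℕ × ℕ, eLpNorm (⇑((huL N.1).toLp (u N.1)) - ⇑((huL N.2).toLp (u N.2)))
        (ENNReal.ofReal p') volume ≤ A * (eLpNorm (g N.1 - g₀) (ENNReal.ofReal p) volume +
          eLpNorm (g N.2 - g₀) (ENNReal.ofReal p) volume) := fun N => by
      rw [eLpNorm_congr_ae ((huL N.1).coeFn_toLp.sub (huL N.2).coeFn_toLp),
        ← fourierInv_sub_of_integrable (hgi _) (hgi _)]
      refine (hA _ ((hgc _).sub (hgc _)).measurable ((hgi _).sub (hgi _))
        ((hgL _).sub (hgL _))).trans ?_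
      gcongr
      have e : g N.1 - g N.2 = (g N.1 - g₀) - (g N.2 - g₀) := by abel
      rw [e]
      exact eLpNorm_sub_le ((hgc _).sub hg₀c).aestronglyMeasurable
        ((hgc _).sub hg₀c).aestronglyMeasurable hE.one_le
    refine tendsto_of_tendsto_of_tendsto_of_le_of_le tendsto_const_nhds ?_ (fun _ => zero_le)
      hbound
    rw [← prod_atTop_atTop_eq]
    have := ENNReal.Tendsto.const_mul (a := (A : ℝ≥0∞))
      ((hglim.comp tendsto_fst).add (hglim.comp tendsto_snd)) (Or.inr ENNReal.coe_ne_top)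
    simpa using this
  obtain ⟨U, hU⟩ := cauchySeq_tendsto_of_complete hucauchy
  have hU2 : Tendsto (fun n => eLpNorm (u n - ⇑U) (ENNReal.ofReal p') volume) atTop (𝓝 0) := by
    refine ((Lp.tendsto_Lp_iff_tendsto_eLpNorm' _ _).1 hU).congr fun n => ?_
    exact eLpNorm_congr_ae ((huL n).coeFn_toLp.sub (EventuallyEq.refl _ _))
  obtain ⟨k, -, hk⟩ := (tendstoInMeasure_of_tendsto_eLpNorm hp'ne
    (fun n => (huc n).aestronglyMeasurable) (Lp.aestronglyMeasurable U) hU2).exists_seq_tendsto_ae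
  -- the limit function
  set φ : ℝ → ℂ := fun t => Complex.exp t * U t with hφdef
  have hφm : AEStronglyMeasurable φ volume :=
    (by fun_prop : Continuous fun t : ℝ => Complex.exp t).aestronglyMeasurable.mul
      (Lp.aestronglyMeasurable U)
  have hbrL : ∀ n, eLpNorm (bromwich (K n)) (ENNReal.ofReal p') volume ≤ A * B := fun n =>
    eLpNorm_bromwich_le hA (hK n) (hC n) (hKB n)
  -- The factor `e^t` is unbounded, so `U ∈ L^{p'}` is not enough; Fatou along the almost everywhere
  -- convergent subsequence uses the uniform bound on the Bromwich integrals.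
  have hφb : eLpNorm φ (ENNReal.ofReal p') volume ≤ A * B := by
    refine Lp.eLpNorm_le_of_ae_tendsto (u := atTop) (f := fun n => bromwich (K (k n)))
      (Eventually.of_forall fun n => hbrL _)
      (fun n => (continuous_bromwich (hK _) (hC _)).aestronglyMeasurable) ?_
    filter_upwards [hk] with t ht
    simp_rw [hubr]
    exact ht.const_mul _
  have hφL : MemLp φ (ENNReal.ofReal p') (volume.restrict (Ioi 0)) :=
    MemLp.restrict _ ⟨hφm, hφb.trans_lt (by finiteness)⟩
  have hbrM : ∀ n, MemLp (bromwich (K n)) (ENNReal.ofReal p') (volume.restrict (Ioi 0)) := fun n =>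
    MemLp.restrict _ ⟨(continuous_bromwich (hK _) (hC _)).aestronglyMeasurable,
      (hbrL n).trans_lt (by finiteness)⟩
  -- For `Re s > 1` the weight `e^{-(s-1)t}` left over after cancelling `e^t` is in `L^p`, so Hölder
  -- passes the `L^{p'}` convergence of `u n` to the Laplace transforms. Analyticity then extends
  -- the identity to `Re s > 0`.
  have hright : ∀ s : ℂ, 1 < s.re → laplace φ s = G s := fun s hs => by
    have hs0 : 0 < s.re := one_pos.trans hs
    have hlim1 : Tendsto (fun n => laplace (bromwich (K n)) s) atTop (𝓝 (laplace φ s)) := by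
      refine tendsto_integral_of_L1' _ (integrableOn_exp_mul hconj hφL hs0).1
        (Eventually.of_forall fun n => integrableOn_exp_mul hconj (hbrM n) hs0) ?_
      set e : ℝ → ℂ := fun t => Complex.exp (-(s - 1) * t)
      have he : MemLp e (ENNReal.ofReal p) (volume.restrict (Ioi 0)) := by
        refine (memLp_exp_neg_mul hp0 (sub_pos.2 hs)).congr_norm (by fun_prop)
          (ae_of_all _ fun t => ?_)
        simp [e, Complex.norm_exp]
      have hle : ∀ n, eLpNorm ((fun t : ℝ => Complex.exp (-s * t) * bromwich (K n) t) -
          fun t : ℝ => Complex.exp (-s * t) * φ t) 1 (volume.restrict (Ioi 0)) ≤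
          eLpNorm e (ENNReal.ofReal p) (volume.restrict (Ioi 0)) *
            eLpNorm (u n - ⇑U) (ENNReal.ofReal p') volume := fun n => by
        have e1 : ((fun t : ℝ => Complex.exp (-s * t) * bromwich (K n) t) -
            fun t : ℝ => Complex.exp (-s * t) * φ t) = e • (u n - ⇑U) := by
          ext t
          simp only [Pi.sub_apply, Pi.smul_apply', smul_eq_mul, hubr, hφdef, e, ← mul_sub,
            ← mul_assoc, ← Complex.exp_add]
          congr 2
          ring
        rw [e1]
        refine (eLpNorm_smul_le_mul_eLpNorm (p := ENNReal.ofReal p) (q := ENNReal.ofReal p')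
          ((huc n).aestronglyMeasurable.sub (Lp.aestronglyMeasurable U)).restrict he.1).trans ?_
        gcongr
        exact Measure.restrict_le_self
      refine tendsto_of_tendsto_of_tendsto_of_le_of_le tendsto_const_nhds ?_ (fun _ => zero_le) hle
      have := ENNReal.Tendsto.const_mul hU2 (Or.inr he.2.ne)
      rwa [mul_zero] at this
    have hlim2 : Tendsto (fun n => laplace (bromwich (K n)) s) atTop (𝓝 (G s)) := by
      have h := (tendsto_regularizer s).mul_const (G s)
      rw [one_mul] at h
      refine h.congr fun n => ?_
      exact (laplace_bromwich (hK n) (hC n) hs0).symm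
    exact tendsto_nhds_unique hlim1 hlim2
  have hall : EqOn (laplace φ) G RightHalfPlane := by
    refine (analyticOnNhd_laplace hconj hφL).eqOn_of_preconnected_of_eventuallyEq hGa
      isPreconnected_rightHalfPlane (z₀ := 2) (by simp [RightHalfPlane]) ?_
    filter_upwards [(isOpen_lt continuous_const Complex.continuous_re).mem_nhds
      (show (2 : ℂ) ∈ {s : ℂ | 1 < s.re} by simp)] with s hs using hright s hs
  refine ⟨hφL.toLp φ, fun s hs => Eq.trans ?_ (hall hs)⟩
  refine integral_congr_ae ?_
  filter_upwards [hφL.coeFn_toLp] with t ht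
  rw [ht]

end NonlocalEq

/-! ### Existence and uniqueness of the solution -/

theorem theorem2 (p p' : ℝ) (hp : 1 < p) (hp2 : p ≤ 2) (hpp' : 1 / p + 1 / p' = 1)
    -- the symbol: analytic on a region containing the half-plane, not identically zero
    (f : ℂ → ℂ) (D : Set ℂ) (hD : NonlocalEq.IsRegion D) (hDsub : NonlocalEq.RightHalfPlane ⊆ D)
    (hf : AnalyticOnNhd ℂ f D) (hf0 : ∃ s ∈ D, f s ≠ 0)
    -- the fixed analytic function
    (r : ℂ → ℂ) (E : Set ℂ) (hE : NonlocalEq.IsRegion E)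
    (hEmeet : (E ∩ NonlocalEq.RightHalfPlane).Nonempty) (hr : AnalyticOnNhd ℂ r E)
    (J : NonlocalEq.LpHalfLine p') (hJ : NonlocalEq.MemHardy p (NonlocalEq.laplace J))
    -- the quotient `(L(J) + r) / f` is the function `G` of the Hardy space
    (G : ℂ → ℂ)
    (hG : NonlocalEq.IsHardyFunction p {s | s ∈ E ∩ NonlocalEq.RightHalfPlane ∧ f s ≠ 0}
      (fun s => (NonlocalEq.laplace J s + r s) / f s) G) :
    ∃ φ : NonlocalEq.LpHalfLine p',
      -- it is the one and only solution
      (∀ ψ : NonlocalEq.LpHalfLine p', NonlocalEq.IsSolution p p' f r E J ψ ↔ ψ = φ) ∧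
      -- and it is the (unique) inverse Laplace transform of the quotient
      (∀ ψ : NonlocalEq.LpHalfLine p', NonlocalEq.IsInverseLaplace p' G ψ ↔ ψ = φ) := by
  obtain ⟨φ, hφ⟩ := NonlocalEq.exists_isInverseLaplace hp hp2 hpp' hG.1
  have hconj := NonlocalEq.holderConjugate_ofReal hp hpp'
  have hlap : ∀ ψ : NonlocalEq.LpHalfLine p',
      AnalyticOnNhd ℂ (NonlocalEq.laplace ψ) NonlocalEq.RightHalfPlane := fun ψ =>
    NonlocalEq.analyticOnNhd_laplace hconj (Lp.memLp ψ)
  have hne : ∀ z ∈ D, ∀ᶠ s in 𝓝[≠] z, f s ≠ 0 := fun z hz => by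
    by_contra h
    obtain ⟨s, hs, hs0⟩ := hf0
    refine hs0 (hf.eqOn_zero_of_preconnected_of_frequently_eq_zero hD.2.isPreconnected hz ?_ hs)
    exact (not_eventually.1 h).mono fun _ => not_not.1
  have hopen : IsOpen (E ∩ NonlocalEq.RightHalfPlane) :=
    hE.1.inter NonlocalEq.isOpen_rightHalfPlane
  have hgood : ∀ z ∈ E ∩ NonlocalEq.RightHalfPlane, ∀ᶠ s in 𝓝[≠] z,
      s ∈ E ∩ NonlocalEq.RightHalfPlane ∧ f s ≠ 0 := fun z hz =>
    Eventually.and (mem_nhdsWithin_of_mem_nhds (hopen.mem_nhds hz)) (hne z (hDsub hz.2))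
  have huniq : ∀ ψ : NonlocalEq.LpHalfLine p', NonlocalEq.IsInverseLaplace p' G ψ → ψ = φ :=
    fun ψ hψ => NonlocalEq.eq_of_eqOn_laplace hconj (hψ.trans hφ.symm)
  refine ⟨φ, fun ψ => ⟨?_, ?_⟩, fun ψ => ⟨huniq ψ, ?_⟩⟩
  · rintro ⟨Φ, hΦ, hΦJ⟩
    obtain ⟨z, hz⟩ := hEmeet
    -- Agreement near one point suffices: `L(ψ)` and `G` are both analytic on the whole half-plane,
    -- which is connected even if `E ∩ RightHalfPlane` is not.
    refine huniq ψ ((hlap ψ).eqOn_of_preconnected_of_frequently_eq hG.1.1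
      NonlocalEq.isPreconnected_rightHalfPlane hz.2 ?_)
    refine Eventually.frequently ?_
    filter_upwards [hgood z hz] with s hs
    have h1 := hΦ.2 hs.1
    have h2 := hΦJ hs.1.2
    have h3 := hG.2 hs
    simp only at h1 h3
    rw [h3, eq_div_iff hs.2, h2, h1]
    ring
  · rintro rfl
    refine ⟨NonlocalEq.laplace J, ⟨hJ, fun z hz => ?_⟩, fun _ _ => rfl⟩
    have c1 : ContinuousAt (NonlocalEq.laplace J) z := (hlap J z hz.2).continuousAt
    have c2 : ContinuousAt (fun s => f s * NonlocalEq.laplace ψ s - r s) z :=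
      ((hf z (hDsub hz.2)).continuousAt.mul (hlap ψ z hz.2).continuousAt).sub
        (hr z hz.1).continuousAt
    -- The identity can be divided out only where `f ≠ 0`; at a zero of `f` both sides are
    -- continuous and agree on a punctured neighbourhood.
    refine tendsto_nhds_unique_of_eventuallyEq (c1.tendsto.mono_left nhdsWithin_le_nhds)
      (c2.tendsto.mono_left nhdsWithin_le_nhds) (l := 𝓝[≠] z) ?_
    filter_upwards [hgood z hz] with s hs
    have h3 := hG.2 hs
    simp only at h3
    rw [hφ hs.1.2, h3, mul_div_cancel₀ _ hs.2]
    ring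
  · rintro rfl
    exact hφ

end
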